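/- Let $A$ be a finite alphabet and let $\mathtt a\in A$. For a set $V$ of variables, a pattern over $V$ is a word in $(A\cup V)^*$; an assignment $h\colon V\to A^*$ extends to patterns as the monoid morphism that fixes every letter of $A$. Consider sentences $$\exists x_1,\dots,x_n\,\forall y_1,\dots,y_m\;\varphi \qquad (n,m\ge 0),$$ where all variables range over $A^*$ and $\varphi$ is built with $\wedge$ and $\vee$ only (no negation) from atoms of two kinds: word equations $U=V$, where $U,V$ are patterns over $\{x_1,\dots,x_n,y_1,\dots,y_m\}$ in which no terminal other than $\mathtt a$ occurs (although $A$ may have further letters); and length predicates $\mathrm{Length}(U,V)$, where $U,V$ are patterns over $A$ and these variables (in particular, variables or constant words), meaning $|h(U)|=|h(V)|$. Then: 1. It is decidable whether such a sentence is true in $A^*$: the set of the codes of the true sentences of this form is a computable set, where a sentence is coded as $n$, $m$ and the formula $\varphi$ in prefix notation. 2. Suppose that $|A|\ge 2$, and let $\bigvee_s\bigwedge_r e_{s,r}$ be the disjunctive normal form of $\varphi$ obtained by distributing $\wedge$ over $\vee$. For all words $w_1,\dots,w_n\in A^*$, the formula $\forall y_1,\dots,y_m\,\varphi(w_1,\dots,w_n,y_1,\dots,y_m)$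 is true if and only if there is an $s$ such that, after substituting $w_i$ for $x_i$ for all $i$, every atom $e_{s,r}$ of the $s$-th disjunct is trivial. Here a word equation over the $y_j$ is trivial if its two sides are identical as patterns, and $\mathrm{Length}(U,V)$ is trivial if every $y_j$ occurs equally often in $U$ and in $V$ and $U,V$ contain equally many occurrences of terminals (for instance, $\mathrm{Length}(z,z)$). -/

import Mathlib

/-! Word equations over an alphabet `A`, positive formulae over word equations and the length
predicate, and positive `∃∀`-sentences, together with a concrete coding of sentences. -/

namespace WordEq

/-- A pattern: a word over terminals in `A` and variables in `V`. -/
abbrev Pattern (A V : Type*) := List (A ⊕ V)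

/-- The image `h(U)` of a pattern under the morphism that fixes every terminal and sends each
variable `v` to the word `h v`. -/
def Pattern.eval {A V : Type*} (h : V → List A) (U : Pattern A V) : List A :=
  U.flatMap (Sum.elim (fun c => [c]) h)

/-- The pattern over the variables `Y` alone that results from assigning the words `x` to the
variables `X` of a pattern. -/
def Pattern.assign {A X Y : Type*} (x : X → List A) (U : Pattern A (X ⊕ Y)) : Pattern A Y :=
  U.flatMap (Sum.elim (fun c => [Sum.inl c])
    (Sum.elim (fun i => (x i).map Sum.inl) (fun j => [Sum.inr j])))

/-- The sequence of variable occurrences in a pattern (all terminals are erased). -/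
def Pattern.varSeq {A V : Type*} (U : Pattern A V) : List V :=
  U.filterMap Sum.getRight?

/-- Atomic formulae: word equations `U = V`, and length predicates `Length(U, V)`. -/
inductive Atom (A V : Type*) where
  | eqn (L R : Pattern A V) : Atom A V
  | len (L R : Pattern A V) : Atom A V

/-- Truth of an atom under an assignment of words to its variables. -/
def Atom.Holds {A V : Type*} (h : V → List A) : Atom A V → Prop
  | .eqn U V => U.eval h = V.eval h
  | .len U V => (U.eval h).length = (V.eval h).length

/-- If the atom is a word equation, then the only terminal that may occur in it is `a`. -/
def Atom.OnlyTerminal {A V : Type*} (a : A) : Atom A V → Prop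
  | .eqn U V => ∀ c : A, Sum.inl c ∈ U ++ V → c = a
  | .len _ _ => True

/-- The atom that results from assigning the words `x` to the variables `X`. -/
def Atom.assign {A X Y : Type*} (x : X → List A) : Atom A (X ⊕ Y) → Atom A Y
  | .eqn U V => .eqn (U.assign x) (V.assign x)
  | .len U V => .len (U.assign x) (V.assign x)

/-- A word equation is trivial if its two sides are the same pattern. A length predicate is
trivial if its two arguments contain each variable equally often and equally many terminals. -/
def Atom.IsTrivial {A V : Type*} : Atom A V → Prop
  | .eqn U V => U = V
  | .len U V => U.varSeq.Perm V.varSeq ∧ U.length = V.length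

/-- Positive quantifier-free formulae: built from atoms by conjunction and disjunction only. -/
inductive PosFormula (A V : Type*) where
  | atom (e : Atom A V) : PosFormula A V
  | and (φ ψ : PosFormula A V) : PosFormula A V
  | or (φ ψ : PosFormula A V) : PosFormula A V

namespace PosFormula

/-- Truth of a formula under an assignment of words to its variables. -/
def Holds {A V : Type*} (h : V → List A) : PosFormula A V → Prop
  | atom e => e.Holds h
  | and φ ψ => φ.Holds h ∧ ψ.Holds h
  | or φ ψ => φ.Holds h ∨ ψ.Holds h

/-- Every word equation in the formula contains no terminal other than `a`. -/
def OnlyTerminal {A V : Type*} (a : A) : PosFormula A V → Prop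
  | atom e => e.OnlyTerminal a
  | and φ ψ => φ.OnlyTerminal a ∧ ψ.OnlyTerminal a
  | or φ ψ => φ.OnlyTerminal a ∧ ψ.OnlyTerminal a

/-- The disjunctive normal form obtained by distributing conjunctions over disjunctions: the list
of its disjuncts, each of them the list of the atoms whose conjunction it is. -/
def dnf {A V : Type*} : PosFormula A V → List (List (Atom A V))
  | atom e => [[e]]
  | and φ ψ => φ.dnf.flatMap fun c => ψ.dnf.map fun d => c ++ d
  | or φ ψ => φ.dnf ++ ψ.dnf

end PosFormula

/-- A positive `Σ₂` sentence `∃ x₁ … xₙ. ∀ y₁ … yₘ. φ`, with `φ` positive and quantifier-free;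
`Sum.inl i` is the variable `xᵢ` and `Sum.inr j` is the variable `yⱼ`. -/
structure Sentence (A : Type*) where
  /-- number of existentially quantified variables -/
  n : ℕ
  /-- number of universally quantified variables -/
  m : ℕ
  /-- the quantifier-free part -/
  body : PosFormula A (Fin n ⊕ Fin m)

/-- Truth of a sentence, all variables ranging over the words over `A`. -/
def Sentence.Holds {A : Type*} (S : Sentence A) : Prop :=
  ∃ x : Fin S.n → List A, ∀ y : Fin S.m → List A, S.body.Holds (Sum.elim x y)

/-! ### Coding of sentences as finite data

A sentence is written as the triple of `n`, `m` and its quantifier-free part in prefix (Polish)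
notation, with variables written as natural numbers. -/

/-- A pattern as it appears in a code. -/
abbrev PatternCode (A : Type*) := List (A ⊕ (ℕ ⊕ ℕ))

/-- The symbols of the prefix notation: `inl true` is `∧`, `inl false` is `∨`, `inr (inl (U, V))`
is the atom `U = V`, and `inr (inr (U, V))` is the atom `Length(U, V)`. -/
abbrev Token (A : Type*) :=
  Bool ⊕ ((PatternCode A × PatternCode A) ⊕ (PatternCode A × PatternCode A))

/-- Codes of sentences. -/
abbrev SentenceCode (A : Type*) := ℕ × ℕ × List (Token A)

def Pattern.code {A : Type*} {n m : ℕ} (U : Pattern A (Fin n ⊕ Fin m)) : PatternCode A :=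
  U.map (Sum.map id (Sum.map Fin.val Fin.val))

def Atom.code {A : Type*} {n m : ℕ} : Atom A (Fin n ⊕ Fin m) → Token A
  | .eqn U V => Sum.inr (Sum.inl (Pattern.code U, Pattern.code V))
  | .len U V => Sum.inr (Sum.inr (Pattern.code U, Pattern.code V))

def PosFormula.code {A : Type*} {n m : ℕ} : PosFormula A (Fin n ⊕ Fin m) → List (Token A)
  | .atom e => [e.code]
  | .and φ ψ => Sum.inl true :: (φ.code ++ ψ.code)
  | .or φ ψ => Sum.inl false :: (φ.code ++ ψ.code)

def Sentence.code {A : Type*} (S : Sentence A) : SentenceCode A :=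
  (S.n, S.m, S.body.code)

/-! Distinct sentences have distinct codes. -/

theorem Pattern.code_injective {A : Type*} {n m : ℕ} :
    Function.Injective (Pattern.code : Pattern A (Fin n ⊕ Fin m) → PatternCode A) :=
  List.map_injective_iff.2
    (Function.injective_id.sumMap (Fin.val_injective.sumMap Fin.val_injective))

theorem Atom.code_injective {A : Type*} {n m : ℕ} :
    Function.Injective (Atom.code : Atom A (Fin n ⊕ Fin m) → Token A) := by
  rintro (⟨U, V⟩ | ⟨U, V⟩) (⟨U', V'⟩ | ⟨U', V'⟩) h <;>
    simp_all [Atom.code, Pattern.code_injective.eq_iff]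

theorem PosFormula.code_append_inj {A : Type*} {n m : ℕ} (φ : PosFormula A (Fin n ⊕ Fin m)) :
    ∀ (ψ : PosFormula A (Fin n ⊕ Fin m)) (r s : List (Token A)),
      φ.code ++ r = ψ.code ++ s → φ = ψ ∧ r = s := by
  induction φ with
  | atom e =>
    rintro (e' | ⟨p, q⟩ | ⟨p, q⟩) r s h
    · simpa [PosFormula.code, Atom.code_injective.eq_iff] using h
    all_goals cases e <;> simp [PosFormula.code, Atom.code] at h
  | and φ₁ φ₂ ih₁ ih₂ =>
    rintro (e' | ⟨p, q⟩ | ⟨p, q⟩) r s h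
    · cases e' <;> simp [PosFormula.code, Atom.code] at h
    · simp only [PosFormula.code, List.cons_append, List.append_assoc, List.cons.injEq,
        true_and] at h
      obtain ⟨rfl, h'⟩ := ih₁ _ _ _ h
      obtain ⟨rfl, rfl⟩ := ih₂ _ _ _ h'
      exact ⟨rfl, rfl⟩
    · simp [PosFormula.code] at h
  | or φ₁ φ₂ ih₁ ih₂ =>
    rintro (e' | ⟨p, q⟩ | ⟨p, q⟩) r s h
    · cases e' <;> simp [PosFormula.code, Atom.code] at h
    · simp [PosFormula.code] at h
    · simp only [PosFormula.code, List.cons_append, List.append_assoc, List.cons.injEq,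
        true_and] at h
      obtain ⟨rfl, h'⟩ := ih₁ _ _ _ h
      obtain ⟨rfl, rfl⟩ := ih₂ _ _ _ h'
      exact ⟨rfl, rfl⟩

theorem Sentence.code_injective {A : Type*} :
    Function.Injective (Sentence.code : Sentence A → SentenceCode A) := by
  rintro ⟨n, m, φ⟩ ⟨n', m', ψ⟩ h
  simp only [Sentence.code, Prod.mk.injEq] at h
  obtain ⟨rfl, rfl, h⟩ := h
  obtain ⟨rfl, -⟩ := PosFormula.code_append_inj φ ψ [] [] (by simpa using h)
  rfl

end WordEq

/-!
A positive formula in the variables `yⱼ` holds for all words `yⱼ` only if one of its disjuncts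
consists of identities. Indeed a single assignment falsifies every atom of the formula that is not
an identity (`exists_forall_not_holds`): send `yⱼ` to `bᴷ aʲ⁺¹ b ⋯ b`, a word of length
`B ^ (j + 1)`, with `K` and then `B` large. For a length predicate, the numbers of occurrences of
the `yⱼ` and of the terminals are digits in base `B` of the lengths of its two sides. In a word
equation, compare the first symbols in which the two sides differ: the images of two variables
differ in the block of letters `a`, and a few terminals cannot imitate the block `bᴷ`. Over an
alphabet with one letter, a word equation is nothing but a length predicate. This is
`PosFormula.forall_holds_iff`, which makes the second part of the theorem immediate.

For the first part it remains to decide whether words `xᵢ` exist for which the atoms of some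
disjunct become identities. As `a` is the only terminal in the word equations, the `xᵢ` may be
replaced by powers of `a` with the same lengths (`Sentence.holds_iff`). Whether an atom becomes an
identity is then a matter of linear equations in the lengths `kᵢ`: the two sides must have the
same variables `yⱼ`, and the stretches between consecutive `yⱼ` (for word equations), or the entire
sides (for length predicates), must have equal lengths. Such a system of linear equations with a
solution in natural numbers has one below an explicit bound (`exists_small_solution`): reading the
`kᵢ` in binary, an equation is in one of boundedly many states after each digit, and a repetition
of the states allows the digits between to be cut out. Hence a bounded search decides the matter.
On codes, the search is carried out by a stack machine for the prefix notation, whose run also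
tells whether a list of tokens is the code of a formula; everything in it is primitive recursive.
-/

namespace WordEq

/-! ### Evaluating positive formulae -/

/-- The truth value of a positive formula whose atoms have the truth values `p`. -/
def PosFormula.Eval {A V : Type*} (p : Atom A V → Prop) : PosFormula A V → Prop
  | atom e => p e
  | and φ ψ => φ.Eval p ∧ ψ.Eval p
  | or φ ψ => φ.Eval p ∨ ψ.Eval p

/-- The list of all atoms of a formula, with repetitions. -/
def PosFormula.atoms {A V : Type*} : PosFormula A V → List (Atom A V)
  | atom e => [e]
  | and φ ψ => φ.atoms ++ ψ.atoms
  | or φ ψ => φ.atoms ++ ψ.atoms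

theorem PosFormula.Eval.mono {A V : Type*} {p q : Atom A V → Prop} {φ : PosFormula A V}
    (hpq : ∀ e ∈ φ.atoms, p e → q e) (h : φ.Eval p) : φ.Eval q := by
  induction φ with
  | atom e => exact hpq e (by simp [atoms]) h
  | and φ ψ ih₁ ih₂ =>
    exact ⟨ih₁ (fun e he => hpq e (by simp [atoms, he])) h.1,
      ih₂ (fun e he => hpq e (by simp [atoms, he])) h.2⟩
  | or φ ψ ih₁ ih₂ =>
    exact h.imp (ih₁ (fun e he => hpq e (by simp [atoms, he])))
      (ih₂ (fun e he => hpq e (by simp [atoms, he])))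

theorem PosFormula.holds_iff_eval {A V : Type*} (h : V → List A) (φ : PosFormula A V) :
    φ.Holds h ↔ φ.Eval (fun e => e.Holds h) := by
  induction φ with
  | atom e => rfl
  | and φ ψ ih₁ ih₂ => exact and_congr ih₁ ih₂
  | or φ ψ ih₁ ih₂ => exact or_congr ih₁ ih₂

theorem PosFormula.exists_mem_dnf_iff_eval {A V : Type*} (p : Atom A V → Prop)
    (φ : PosFormula A V) : (∃ c ∈ φ.dnf, ∀ e ∈ c, p e) ↔ φ.Eval p := by
  induction φ with
  | atom e => simp [dnf, Eval]
  | and φ ψ ih₁ ih₂ =>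
    simp only [dnf, Eval, ← ih₁, ← ih₂, List.mem_flatMap, List.mem_map]
    constructor
    · rintro ⟨_, ⟨c, hc, d, hd, rfl⟩, h⟩
      exact ⟨⟨c, hc, fun e he => h e (by simp [he])⟩, d, hd, fun e he => h e (by simp [he])⟩
    · rintro ⟨⟨c, hc, h⟩, d, hd, h'⟩
      refine ⟨_, ⟨c, hc, d, hd, rfl⟩, fun e he => ?_⟩
      exact (List.mem_append.1 he).elim (h e) (h' e)
  | or φ ψ ih₁ ih₂ =>
    simp only [dnf, Eval, ← ih₁, ← ih₂, List.mem_append, or_and_right, exists_or]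

theorem PosFormula.OnlyTerminal.of_mem_atoms {A V : Type*} {a : A} {φ : PosFormula A V}
    (h : φ.OnlyTerminal a) : ∀ e ∈ φ.atoms, e.OnlyTerminal a := by
  induction φ with
  | atom e =>
    intro e' he
    obtain rfl := List.mem_singleton.1 he
    exact h
  | and φ ψ ih₁ ih₂ =>
    intro e he
    exact (List.mem_append.1 he).elim (ih₁ h.1 e) (ih₂ h.2 e)
  | or φ ψ ih₁ ih₂ =>
    intro e he
    exact (List.mem_append.1 he).elim (ih₁ h.1 e) (ih₂ h.2 e)

/-! ### Patterns with their terminals identified -/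

@[simp] theorem Pattern.eval_nil {A V : Type*} (h : V → List A) :
    Pattern.eval h ([] : Pattern A V) = [] := rfl

@[simp] theorem Pattern.eval_cons_inl {A V : Type*} (h : V → List A) (c : A) (U : Pattern A V) :
    Pattern.eval h (Sum.inl c :: U) = c :: U.eval h := rfl

@[simp] theorem Pattern.eval_cons_inr {A V : Type*} (h : V → List A) (v : V) (U : Pattern A V) :
    Pattern.eval h (Sum.inr v :: U) = h v ++ U.eval h := rfl

@[simp] theorem Pattern.assign_cons_inl {A X Y : Type*} (x : X → List A) (c : A)
    (U : Pattern A (X ⊕ Y)) :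
    Pattern.assign x (Sum.inl c :: U) = Sum.inl c :: U.assign x := rfl

@[simp] theorem Pattern.assign_cons_inr_inl {A X Y : Type*} (x : X → List A) (i : X)
    (U : Pattern A (X ⊕ Y)) :
    Pattern.assign x (Sum.inr (Sum.inl i) :: U) = (x i).map Sum.inl ++ U.assign x := rfl

@[simp] theorem Pattern.assign_cons_inr_inr {A X Y : Type*} (x : X → List A) (j : Y)
    (U : Pattern A (X ⊕ Y)) :
    Pattern.assign x (Sum.inr (Sum.inr j) :: U) = Sum.inr j :: U.assign x := rfl

theorem Pattern.eval_append {A V : Type*} (h : V → List A) (U U' : Pattern A V) :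
    Pattern.eval h (U ++ U') = U.eval h ++ U'.eval h := by
  simp [Pattern.eval]

theorem Pattern.eval_map_inl {A V : Type*} (h : V → List A) (w : List A) :
    Pattern.eval h (w.map Sum.inl : Pattern A V) = w := by
  induction w with
  | nil => rfl
  | cons c w ih => simp [ih]

theorem Pattern.eval_assign {A X Y : Type*} (x : X → List A) (y : Y → List A)
    (U : Pattern A (X ⊕ Y)) : (U.assign x).eval y = U.eval (Sum.elim x y) := by
  induction U with
  | nil => rfl
  | cons s U ih =>
    rcases s with c | i | j <;> simp [ih, Pattern.eval_append, Pattern.eval_map_inl]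

theorem Atom.assign_holds {A X Y : Type*} (x : X → List A) (y : Y → List A)
    (e : Atom A (X ⊕ Y)) : (e.assign x).Holds y ↔ e.Holds (Sum.elim x y) := by
  cases e <;> simp [Atom.assign, Atom.Holds, Pattern.eval_assign]

/-- The word obtained from a pattern by forgetting which terminals occur in it: every terminal is
written as `0`, and the variable `yⱼ` as `j + 1`. -/
def Pattern.collapse {A : Type*} {m : ℕ} (U : Pattern A (Fin m)) : List ℕ :=
  U.map (Sum.elim (fun _ => 0) (fun j : Fin m => (j : ℕ) + 1))

@[simp] theorem Pattern.collapse_nil {A : Type*} {m : ℕ} :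
    Pattern.collapse ([] : Pattern A (Fin m)) = [] := rfl

@[simp] theorem Pattern.collapse_cons_inl {A : Type*} {m : ℕ} (c : A) (U : Pattern A (Fin m)) :
    Pattern.collapse (Sum.inl c :: U) = 0 :: U.collapse := rfl

@[simp] theorem Pattern.collapse_cons_inr {A : Type*} {m : ℕ} (j : Fin m)
    (U : Pattern A (Fin m)) :
    Pattern.collapse (Sum.inr j :: U) = ((j : ℕ) + 1) :: U.collapse := rfl

@[simp] theorem Pattern.varSeq_nil {A V : Type*} : Pattern.varSeq ([] : Pattern A V) = [] := rfl

@[simp] theorem Pattern.varSeq_cons_inl {A V : Type*} (c : A) (U : Pattern A V) :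
    Pattern.varSeq (Sum.inl c :: U) = U.varSeq := rfl

@[simp] theorem Pattern.varSeq_cons_inr {A V : Type*} (v : V) (U : Pattern A V) :
    Pattern.varSeq (Sum.inr v :: U) = v :: U.varSeq := rfl

theorem Pattern.collapse_perm_iff {A : Type*} {m : ℕ} (U V : Pattern A (Fin m)) :
    U.collapse.Perm V.collapse ↔ U.varSeq.Perm V.varSeq ∧ U.length = V.length := by
  have key : ∀ U : Pattern A (Fin m), U.collapse.Perm
      (List.replicate (U.length - U.varSeq.length) 0 ++
        U.varSeq.map fun j : Fin m => (j : ℕ) + 1) := by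
    intro U
    induction U with
    | nil => simp
    | cons s U ih =>
      have hle : (Pattern.varSeq U).length ≤ U.length := List.length_filterMap_le _ _
      rcases s with c | j
      · have : U.length + 1 - (Pattern.varSeq U).length
            = U.length - (Pattern.varSeq U).length + 1 := by omega
        simpa [this, List.replicate_succ] using ih
      · have := (ih.cons ((j : ℕ) + 1)).trans List.perm_middle.symm
        simpa using this
  constructor
  · intro h
    refine ⟨?_, by simpa [collapse] using h.length_eq⟩
    have h' := h.filterMap (fun i => if i = 0 then none else some i)
    have hf : ∀ U : Pattern A (Fin m),
        U.collapse.filterMap (fun i => if i = 0 then none else some i)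
          = U.varSeq.map (fun j : Fin m => (j : ℕ) + 1) := by
      intro U
      induction U with
      | nil => rfl
      | cons s U ih => rcases s with c | j <;> simpa using ih
    rw [hf, hf] at h'
    have hinj : Function.Injective (fun j : Fin m => (j : ℕ) + 1) :=
      fun i j hij => Fin.ext (Nat.succ_injective hij)
    exact (List.map_perm_map_iff hinj).1 h'
  · rintro ⟨h₁, h₂⟩
    refine (key U).trans (List.Perm.trans ?_ (key V).symm)
    rw [h₂, h₁.length_eq]
    exact (h₁.map _).append_left _

/-- Two patterns in which `a` is the only terminal are equal once their collapses are. -/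
theorem Pattern.eq_of_collapse_eq {A : Type*} {m : ℕ} {a : A} {U V : Pattern A (Fin m)}
    (hU : ∀ c, Sum.inl c ∈ U → c = a) (hV : ∀ c, Sum.inl c ∈ V → c = a)
    (h : U.collapse = V.collapse) : U = V := by
  induction U generalizing V with
  | nil => cases V with
    | nil => rfl
    | cons t V => rcases t with c | j <;> simp at h
  | cons s U ih =>
    cases V with
    | nil => rcases s with c | j <;> simp at h
    | cons t V =>
      simp only [collapse, List.map_cons, List.cons.injEq] at h
      rw [ih (fun c hc => hU c (by simp [hc])) (fun c hc => hV c (by simp [hc])) h.2]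
      congr 1
      rcases s with c | i <;> rcases t with d | j
      · rw [hU c (by simp), hV d (by simp)]
      · simp at h
      · simp at h
      · simpa [Fin.ext_iff] using h.1

theorem Pattern.only_terminal_assign_replicate {A X Y : Type*} {a : A} {U : Pattern A (X ⊕ Y)}
    (hU : ∀ c, Sum.inl c ∈ U → c = a) (k : X → ℕ) :
    ∀ c, Sum.inl c ∈ U.assign (fun i => List.replicate (k i) a) → c = a := by
  intro c hc
  obtain ⟨s, hs, hcs⟩ := List.mem_flatMap.1 hc
  rcases s with d | i | j
  · simp only [Sum.elim_inl, List.mem_singleton, Sum.inl.injEq] at hcs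
    exact hcs ▸ hU d hs
  · simp at hcs
    exact hcs.2
  · simp at hcs

/-! ### Atoms that hold under every assignment -/

/-- The atoms that hold under all assignments of words to the variables. Over an alphabet with one
letter, a word equation says no more than the corresponding length predicate. -/
def Atom.IsIdentity {A : Type*} {m : ℕ} : Atom A (Fin m) → Prop
  | .eqn U V => U.collapse.Perm V.collapse ∧ (Nontrivial A → U = V)
  | .len U V => U.collapse.Perm V.collapse

theorem Atom.isIdentity_iff_isTrivial {A : Type*} [Nontrivial A] {m : ℕ} (e : Atom A (Fin m)) :
    e.IsIdentity ↔ e.IsTrivial := by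
  cases e with
  | eqn U V =>
    refine ⟨fun h => h.2 inferInstance, fun h => ?_⟩
    obtain rfl : U = V := h
    exact ⟨.refl _, fun _ => rfl⟩
  | len U V => exact Pattern.collapse_perm_iff U V

theorem Pattern.length_eval {A : Type*} {m : ℕ} (h : Fin m → List A) (g : ℕ → ℕ) (hg : g 0 = 1)
    (hh : ∀ j : Fin m, (h j).length = g (j + 1)) (U : Pattern A (Fin m)) :
    (U.eval h).length = (U.collapse.map g).sum := by
  induction U with
  | nil => rfl
  | cons s U ih => rcases s with c | j <;> simp_all [collapse]; omega

theorem Pattern.length_eval_eq_of_perm {A : Type*} {m : ℕ} {U V : Pattern A (Fin m)}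
    (hp : U.collapse.Perm V.collapse) (h : Fin m → List A) :
    (U.eval h).length = (V.eval h).length := by
  obtain ⟨g, hg, hh⟩ : ∃ g : ℕ → ℕ, g 0 = 1 ∧ ∀ j : Fin m, (h j).length = g (j + 1) :=
    ⟨fun i => if hi : 0 < i ∧ i ≤ m then (h ⟨i - 1, by omega⟩).length else 1, by simp,
      fun j => by simp⟩
  rw [length_eval h g hg hh, length_eval h g hg hh]
  exact (hp.map _).sum_eq

theorem Atom.IsIdentity.holds {A : Type*} {m : ℕ} {e : Atom A (Fin m)} (he : e.IsIdentity)
    (h : Fin m → List A) : e.Holds h := by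
  cases e with
  | eqn U V =>
    by_cases hA : Nontrivial A
    · exact congrArg _ (he.2 hA)
    · have := not_nontrivial_iff_subsingleton.1 hA
      exact List.ext_getElem (Pattern.length_eval_eq_of_perm he.1 h)
        fun _ _ _ => Subsingleton.elim _ _
  | len U V => exact Pattern.length_eval_eq_of_perm he h

/-- Uniqueness of the expansion of a number in base `B`. -/
theorem eq_of_sum_range_mul_pow_eq {B : ℕ} {c d : ℕ → ℕ} (hc : ∀ i, c i < B) (hd : ∀ i, d i < B)
    {N : ℕ} (h : ∑ i ∈ Finset.range N, c i * B ^ i = ∑ i ∈ Finset.range N, d i * B ^ i) :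
    ∀ i < N, c i = d i := by
  induction N generalizing c d with
  | zero => simp
  | succ N ih =>
    simp only [Finset.sum_range_succ', pow_succ, ← mul_assoc, ← Finset.sum_mul, pow_zero,
      mul_one] at h
    have h₀ : c 0 = d 0 := by
      simpa [Nat.add_mod, Nat.mod_eq_of_lt (hc 0), Nat.mod_eq_of_lt (hd 0)] using
        congrArg (· % B) h
    have hB : 0 < B := (Nat.zero_le _).trans_lt (hc 0)
    rw [h₀, Nat.add_right_cancel_iff] at h
    have h' := ih (fun i => hc (i + 1)) (fun i => hd (i + 1)) (Nat.eq_of_mul_eq_mul_right hB h)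
    rintro (_ | i) hi
    · exact h₀
    · exact h' i (by omega)

/-- Lists with fewer than `B` entries are determined, up to the order of the entries, by the sum
of the powers `B ^ p`: the multiplicities are the digits of that sum in base `B`. -/
theorem perm_of_sum_pow_eq {B : ℕ} {P Q : List ℕ} (hP : P.length < B) (hQ : Q.length < B)
    (h : (P.map (B ^ ·)).sum = (Q.map (B ^ ·)).sum) : P.Perm Q := by
  obtain ⟨N, hN⟩ : ∃ N, P.toFinset ∪ Q.toFinset ⊆ Finset.range N :=
    Finset.exists_nat_subset_range _
  have hsum : ∀ R : List ℕ, R.toFinset ⊆ Finset.range N →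
      (R.map (B ^ ·)).sum = ∑ i ∈ Finset.range N, R.count i * B ^ i := by
    intro R hR
    rw [Finset.sum_list_map_count]
    refine Finset.sum_subset hR fun i _ hi => ?_
    simp [List.count_eq_zero_of_not_mem (mt List.mem_toFinset.2 hi)]
  have hPN := Finset.union_subset_left hN
  have hQN := Finset.union_subset_right hN
  rw [hsum P hPN, hsum Q hQN] at h
  have hcount := eq_of_sum_range_mul_pow_eq (fun i => List.count_le_length.trans_lt hP)
    (fun i => List.count_le_length.trans_lt hQ) h
  refine List.perm_iff_count.2 fun i => ?_
  by_cases hi : i < N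
  · exact hcount i hi
  · have hni : ∀ R : List ℕ, R.toFinset ⊆ Finset.range N → R.count i = 0 := fun R hR =>
      List.count_eq_zero_of_not_mem fun hiR =>
        hi (Finset.mem_range.1 (hR (List.mem_toFinset.2 hiR)))
    rw [hni P hPN, hni Q hQN]

/-- The word `bᴷ aʲ⁺¹ b ⋯ b`, of length `B ^ (j + 1)` if `K + j + 2 ≤ B`. Words of this form, with
`K` and then `B` large, are so generic that they satisfy no equation and no length predicate except
identities. -/
def genericWord {A : Type*} (a b : A) (K B j : ℕ) : List A :=
  List.replicate K b ++ (List.replicate (j + 1) a ++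
    b :: List.replicate (B ^ (j + 1) - (K + j + 2)) b)

theorem length_genericWord {A : Type*} (a b : A) {K B j : ℕ} (h : K + j + 2 ≤ B) :
    (genericWord a b K B j).length = B ^ (j + 1) := by
  have : B ≤ B ^ (j + 1) := Nat.le_self_pow (by omega) B
  simp [genericWord]; omega

theorem replicate_append_cons_inj {A : Type*} {a b : A} (hab : a ≠ b) {p q : ℕ} {X Y : List A}
    (h : List.replicate p a ++ b :: X = List.replicate q a ++ b :: Y) : p = q := by
  induction p generalizing q with
  | zero =>
    cases q with
    | zero => rfl
    | succ q => simp [List.replicate_succ, hab.symm] at h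
  | succ p ih =>
    cases q with
    | zero => simp [List.replicate_succ, hab] at h
    | succ q =>
      simp only [List.replicate_succ, List.cons_append, List.cons.injEq, true_and] at h
      rw [ih h]

/-- A pattern with at most `L < K` symbols cannot evaluate to a word that begins with exactly `L`
letters `b`: the terminals before its first variable are too few to make up all `L` of them and
leave the generic word of that variable, which begins with `K` letters `b`, no place. -/
theorem eval_genericWord_ne {A : Type*} {a b : A} (hab : a ≠ b) {K B m L : ℕ}
    {V : Pattern A (Fin m)} (hVL : V.length ≤ L) (hL : L < K) (X : List A) :
    V.eval (fun j : Fin m => genericWord a b K B j) ≠ List.replicate L b ++ a :: X := by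
  induction V generalizing L with
  | nil => simp
  | cons s V ih =>
    intro h
    rcases s with c | j
    · obtain ⟨L, rfl⟩ : ∃ L', L = L' + 1 := ⟨L - 1, by simp at hVL; omega⟩
      simp only [Pattern.eval_cons_inl, List.replicate_succ, List.cons_append, List.cons.injEq] at h
      exact ih (by simpa using hVL) (by omega) h.2
    · simp only [Pattern.eval_cons_inr, genericWord, List.replicate_succ, List.cons_append,
        List.append_assoc] at h
      exact hL.ne' (replicate_append_cons_inj hab.symm h)

theorem Pattern.eq_of_eval_genericWord_eq {A : Type*} {a b : A} (hab : a ≠ b) {K B m : ℕ}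
    {U V : Pattern A (Fin m)} (hU : U.length ≤ K) (hV : V.length ≤ K)
    (h : U.eval (fun j : Fin m => genericWord a b K B j) =
      V.eval (fun j : Fin m => genericWord a b K B j)) :
    U = V := by
  have hne : ∀ (j : Fin m) (X : List A), genericWord a b K B j ++ X ≠ [] := by
    simp [genericWord]
  -- a terminal on one side cannot meet a variable on the other side
  have hcv : ∀ (j : Fin m) (X : List A) (c : A) (W : Pattern A (Fin m)), W.length < K →
      c :: W.eval (fun j : Fin m => genericWord a b K B j) ≠ genericWord a b K B j ++ X := by
    intro j X c W hW h
    obtain ⟨K, rfl⟩ : ∃ K', K = K' + 1 := ⟨K - 1, by omega⟩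
    conv_rhs at h => unfold genericWord
    simp only [List.replicate_succ, List.cons_append, List.append_assoc, List.cons.injEq] at h
    exact eval_genericWord_ne hab (by omega) (Nat.lt_succ_self K) _ h.2
  induction U generalizing V with
  | nil =>
    cases V with
    | nil => rfl
    | cons s V =>
      rcases s with c | j
      · simp at h
      · exact absurd h.symm (hne _ _)
  | cons s U ih =>
    simp only [List.length_cons] at hU
    cases V with
    | nil =>
      rcases s with c | j
      · simp at h
      · exact absurd h (hne _ _)
    | cons t V =>
      simp only [List.length_cons] at hV
      rcases s with c | i <;> rcases t with d | j
      · simp only [eval_cons_inl, List.cons.injEq] at h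
        rw [h.1, ih (by omega) (by omega) h.2]
      · exact absurd h (hcv _ _ _ _ (by omega))
      · exact absurd h.symm (hcv _ _ _ _ (by omega))
      · simp only [eval_cons_inr] at h
        have hij : i = j := by
          have h' := h
          simp only [genericWord, List.append_assoc, List.append_cancel_left_eq,
            List.cons_append] at h'
          exact Fin.ext (Nat.succ_injective (replicate_append_cons_inj hab h'))
        subst hij
        rw [ih (by omega) (by omega) (List.append_cancel_left h)]

/-- The total length of the two patterns of an atom. -/
def Atom.size {A V : Type*} : Atom A V → ℕ
  | .eqn U V => U.length + V.length
  | .len U V => U.length + V.length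

/-- Finitely many atoms that are not identities are falsified by a single assignment. -/
theorem exists_forall_not_holds {A : Type*} (a : A) {m : ℕ} (l : List (Atom A (Fin m)))
    (hl : ∀ e ∈ l, ¬ e.IsIdentity) : ∃ y : Fin m → List A, ∀ e ∈ l, ¬ e.Holds y := by
  obtain ⟨b, hb⟩ : ∃ b, Nontrivial A → a ≠ b := by
    by_cases hA : Nontrivial A
    · obtain ⟨b, hb⟩ := exists_ne a
      exact ⟨b, fun _ => hb.symm⟩
    · exact ⟨a, fun h => absurd h hA⟩
  set K := (l.map Atom.size).sum
  -- the block `bᴷ aʲ⁺¹ b` has to fit into `B` letters for all `j < m`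
  set B := K + m + 2
  have hK : ∀ e ∈ l, e.size ≤ K := fun e he => List.le_sum_of_mem (List.mem_map_of_mem he)
  have hlen : ∀ j : Fin m, (genericWord a b K B j).length = B ^ ((j : ℕ) + 1) :=
    fun j => length_genericWord a b (by omega)
  have hperm : ∀ U V : Pattern A (Fin m), U.length + V.length ≤ K →
      (U.eval fun j : Fin m => genericWord a b K B j).length
        = (V.eval fun j : Fin m => genericWord a b K B j).length → U.collapse.Perm V.collapse := by
    intro U V hUV h
    rw [Pattern.length_eval _ (B ^ ·) (pow_zero B) hlen,
      Pattern.length_eval _ (B ^ ·) (pow_zero B) hlen] at h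
    refine perm_of_sum_pow_eq ?_ ?_ h <;> simp only [Pattern.collapse, List.length_map] <;> omega
  refine ⟨fun j : Fin m => genericWord a b K B j, fun e he h => hl e he ?_⟩
  have hs := hK e he
  cases e with
  | eqn U V =>
    simp only [Atom.size] at hs
    exact ⟨hperm U V hs (congrArg List.length h), fun hA =>
      Pattern.eq_of_eval_genericWord_eq (hb hA) (by omega) (by omega) h⟩
  | len U V => exact hperm U V hs h

/-- A positive formula holds under all assignments to the `yⱼ` exactly if it is made true by those
of its atoms that are identities. -/
theorem PosFormula.forall_holds_iff {A X : Type*} (a : A) {m : ℕ} (φ : PosFormula A (X ⊕ Fin m))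
    (x : X → List A) :
    (∀ y : Fin m → List A, φ.Holds (Sum.elim x y)) ↔
      φ.Eval (fun e => (e.assign x).IsIdentity) := by
  simp only [holds_iff_eval, ← Atom.assign_holds]
  refine ⟨fun h => ?_, fun h y => h.mono fun e _ he => he.holds y⟩
  classical
  obtain ⟨y, hy⟩ := exists_forall_not_holds a
    ((φ.atoms.map (Atom.assign x)).filter fun e => ¬ e.IsIdentity) (by simp)
  refine (h y).mono fun e he hey => ?_
  by_contra hne
  exact hy (e.assign x) (by simpa [hne] using ⟨e, he, rfl⟩) hey

/-! ### Small solutions of linear equations -/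

/-- The solutions in natural numbers of finitely many linear equations `ℓ r k = c r` are small:
whichever of the equations hold for some `k` also hold for some `k'` with entries below
`2 ^ (2 * B + 1) ^ card R`, where `B` bounds the right-hand sides and the sums of the
absolute values of the coefficients. The numbers
`ℓ r ⌊k / 2 ^ i⌋` lie between `-B` and `B`. If they are the same for two values `i < j`, then the
binary digits of `k` at the positions from `i` up to `j` can be cut out. -/
theorem exists_small_solution {R : Type*} [Fintype R] (ℓ : R → (ℕ → ℕ) →+ ℤ) (c : R → ℤ) (B : ℕ)
    (hℓ : ∀ r (k : ℕ → ℕ) (b : ℕ), (∀ i, k i ≤ b) → |ℓ r k| ≤ B * b) (hc : ∀ r, |c r| ≤ B)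
    (k : ℕ → ℕ) (T : ℕ) (hk : ∀ i, k i < 2 ^ T) :
    ∃ k' : ℕ → ℕ, (∀ i, k' i < 2 ^ (2 * B + 1) ^ Fintype.card R) ∧
      ∀ r, ℓ r k = c r → ℓ r k' = c r := by
  classical
  induction T using Nat.strong_induction_on generalizing k with
  | _ T ih =>
  by_cases hT : T < (2 * B + 1) ^ Fintype.card R
  · exact ⟨k, fun i => (hk i).trans_le (Nat.pow_le_pow_right two_pos hT.le), fun _ h => h⟩
  -- the state after `i` digits, at the equations that `k` satisfies
  let st : ℕ → R → ℤ := fun i r => if ℓ r k = c r then ℓ r (fun v => k v / 2 ^ i) else 0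
  have hsplit : ∀ i j r, ℓ r (fun v => k v % 2 ^ i + 2 ^ i * (k v / 2 ^ j))
      = ℓ r (fun v => k v % 2 ^ i) + 2 ^ i * ℓ r (fun v => k v / 2 ^ j) := by
    intro i j r
    have : (fun v => k v % 2 ^ i + 2 ^ i * (k v / 2 ^ j))
        = (fun v => k v % 2 ^ i) + (2 ^ i) • fun v => k v / 2 ^ j := by
      ext v; simp
    rw [this, map_add, map_nsmul]
    simp
  have hself : ∀ i r, ℓ r k = ℓ r (fun v => k v % 2 ^ i) + 2 ^ i * ℓ r (fun v => k v / 2 ^ i) := by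
    intro i r
    rw [← hsplit]
    congr 1
    ext v
    exact (Nat.mod_add_div _ _).symm
  have hst : ∀ i, st i ∈ Fintype.piFinset fun _ : R => Finset.Icc (-B : ℤ) B := by
    intro i
    refine Fintype.mem_piFinset.2 fun r => Finset.mem_Icc.2 (abs_le.1 ?_)
    by_cases hr : ℓ r k = c r
    · simp only [st, if_pos hr]
      have hpos : (0 : ℤ) < 2 ^ i := by positivity
      have h₁ := hℓ r (fun v => k v % 2 ^ i) (2 ^ i - 1)
        fun v => Nat.le_sub_one_of_lt (Nat.mod_lt _ (by positivity))
      rw [Nat.cast_sub Nat.one_le_two_pow] at h₁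
      have h₂ := hself i r
      rw [hr] at h₂
      have h₃ : 2 ^ i * |ℓ r (fun v => k v / 2 ^ i)| ≤ 2 ^ i * (B : ℤ) := by
        rw [← abs_of_pos hpos, ← abs_mul, abs_of_pos hpos, ← sub_eq_of_eq_add' h₂]
        refine (abs_sub _ _).trans ?_
        have := hc r
        push_cast at h₁
        linarith
      exact le_of_mul_le_mul_left h₃ hpos
    · simp [st, if_neg hr]
  obtain ⟨i, hi, j, hj, hij, hsij⟩ := Finset.exists_ne_map_eq_of_card_lt_of_maps_to
    (s := Finset.range (T + 1)) (t := Fintype.piFinset fun _ : R => Finset.Icc (-B : ℤ) B) (f := st)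
    (by
      have : ((B : ℤ) + 1 + B).toNat = 2 * B + 1 := by omega
      simp [this]
      omega) (fun i _ => hst i)
  wlog hlt : i < j generalizing i j
  · exact this j hj i hi hij.symm hsij.symm (by omega)
  have hjT : j ≤ T := Nat.lt_succ_iff.1 (Finset.mem_range.1 hj)
  obtain ⟨k', hk', h'⟩ := ih (i + (T - j)) (by omega)
    (fun v => k v % 2 ^ i + 2 ^ i * (k v / 2 ^ j)) (by
      intro v
      have h₁ : k v % 2 ^ i < 2 ^ i := Nat.mod_lt _ (by positivity)
      have h₂ : k v / 2 ^ j < 2 ^ (T - j) := by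
        rw [Nat.div_lt_iff_lt_mul (by positivity), ← pow_add, Nat.sub_add_cancel hjT]
        exact hk v
      calc k v % 2 ^ i + 2 ^ i * (k v / 2 ^ j) < 2 ^ i + 2 ^ i * (k v / 2 ^ j) := by omega
        _ = 2 ^ i * (k v / 2 ^ j + 1) := by ring
        _ ≤ 2 ^ i * 2 ^ (T - j) := Nat.mul_le_mul_left _ h₂
        _ = 2 ^ (i + (T - j)) := (pow_add _ _ _).symm)
  refine ⟨k', hk', fun r hr => h' r ?_⟩
  have := congrFun hsij r
  simp only [st, if_pos hr] at this
  rw [hsplit, ← this, ← hself, hr]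

/-! ### Codes of patterns under an assignment of powers of one letter -/

/-- The collapse of the pattern with code `U` after assigning a word of length `k i` to each
`xᵢ`. -/
def PatternCode.flat {A : Type*} (k : ℕ → ℕ) (U : PatternCode A) : List ℕ :=
  U.flatMap (Sum.elim (fun _ => [0])
    (Sum.elim (fun i => List.replicate (k i) 0) (fun j => [j + 1])))

@[simp] theorem PatternCode.flat_nil {A : Type*} (k : ℕ → ℕ) :
    PatternCode.flat k ([] : PatternCode A) = [] := rfl

@[simp] theorem PatternCode.flat_cons_inl {A : Type*} (k : ℕ → ℕ) (c : A) (U : PatternCode A) :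
    PatternCode.flat k (Sum.inl c :: U) = 0 :: U.flat k := rfl

@[simp] theorem PatternCode.flat_cons_inr_inl {A : Type*} (k : ℕ → ℕ) (i : ℕ)
    (U : PatternCode A) :
    PatternCode.flat k (Sum.inr (Sum.inl i) :: U) = List.replicate (k i) 0 ++ U.flat k := rfl

@[simp] theorem PatternCode.flat_cons_inr_inr {A : Type*} (k : ℕ → ℕ) (j : ℕ)
    (U : PatternCode A) :
    PatternCode.flat k (Sum.inr (Sum.inr j) :: U) = (j + 1) :: U.flat k := rfl

theorem Pattern.flat_code {A : Type*} {n m : ℕ} (x : Fin n → List A) (k : ℕ → ℕ)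
    (hk : ∀ i : Fin n, k i = (x i).length) (U : Pattern A (Fin n ⊕ Fin m)) :
    (Pattern.code U).flat k = (U.assign x).collapse := by
  induction U with
  | nil => rfl
  | cons s U ih =>
    rcases s with c | i | j
    · simpa [code] using ih
    · have : Pattern.collapse ((x i).map Sum.inl ++ Pattern.assign x U : Pattern A (Fin m))
          = List.replicate (x i).length 0 ++ (Pattern.assign x U).collapse := by
        simp [collapse, Function.comp_def]
      simp only [assign_cons_inr_inl, this, ← ih, ← hk]
      rfl
    · simpa [code] using ih

/-- The token is the code of an atom that becomes an identity when powers of one letter with the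
exponents `k i` are assigned to the `xᵢ`. -/
def Token.IsIdentity {A : Type*} (k : ℕ → ℕ) : Token A → Prop
  | Sum.inl _ => False
  | Sum.inr (Sum.inl p) =>
    (PatternCode.flat k p.1).Perm (PatternCode.flat k p.2) ∧
      (Nontrivial A → PatternCode.flat k p.1 = PatternCode.flat k p.2)
  | Sum.inr (Sum.inr p) => (PatternCode.flat k p.1).Perm (PatternCode.flat k p.2)

theorem Atom.isIdentity_code_of_assign {A : Type*} {n m : ℕ} (x : Fin n → List A) (k : ℕ → ℕ)
    (hk : ∀ i : Fin n, k i = (x i).length) {e : Atom A (Fin n ⊕ Fin m)}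
    (h : (e.assign x).IsIdentity) : Token.IsIdentity k e.code := by
  cases e with
  | eqn U V =>
    simp only [code, Token.IsIdentity, Pattern.flat_code x k hk]
    exact ⟨h.1, fun hA => congrArg _ (h.2 hA)⟩
  | len U V =>
    simp only [code, Token.IsIdentity, Pattern.flat_code x k hk]
    exact h

theorem Atom.isIdentity_assign_of_code {A : Type*} {a : A} {n m : ℕ} {k : ℕ → ℕ}
    {e : Atom A (Fin n ⊕ Fin m)} (he : e.OnlyTerminal a) (h : Token.IsIdentity k e.code) :
    (e.assign fun i : Fin n => List.replicate (k i) a).IsIdentity := by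
  have hk : ∀ i : Fin n, k i = (List.replicate (k i) a).length :=
    fun i => List.length_replicate.symm
  cases e with
  | eqn U V =>
    simp only [code, Token.IsIdentity, Pattern.flat_code _ k hk] at h
    refine ⟨h.1, fun hA => Pattern.eq_of_collapse_eq (a := a) ?_ ?_ (h.2 hA)⟩
    · exact Pattern.only_terminal_assign_replicate (fun c hc => he c (by simp [hc])) _
    · exact Pattern.only_terminal_assign_replicate (fun c hc => he c (by simp [hc])) _
  | len U V =>
    simp only [code, Token.IsIdentity, Pattern.flat_code _ k hk] at h
    exact h

/-- Since `a` is the only terminal in the word equations, replacing every letter of the words `xᵢ`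
by `a` preserves identities. The search for the `xᵢ` is thus a search for their lengths. -/
theorem Sentence.holds_iff {A : Type*} {a : A} (S : Sentence A) (hS : S.body.OnlyTerminal a) :
    S.Holds ↔ ∃ k : ℕ → ℕ, S.body.Eval fun e => Token.IsIdentity k e.code := by
  simp only [Sentence.Holds, PosFormula.forall_holds_iff a]
  constructor
  · rintro ⟨x, h⟩
    refine ⟨fun i => if hi : i < S.n then (x ⟨i, hi⟩).length else 0,
      h.mono fun e _ he => Atom.isIdentity_code_of_assign x _ (fun i => by simp) he⟩
  · rintro ⟨k, h⟩
    exact ⟨_, h.mono fun e he => Atom.isIdentity_assign_of_code (hS.of_mem_atoms e he)⟩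

/-! ### Identities as linear equations -/

/-- The number of zeros in a list that have exactly `t` nonzero entries before them. -/
def zerosAt : List ℕ → ℕ → ℕ
  | [], _ => 0
  | 0 :: P, 0 => zerosAt P 0 + 1
  | 0 :: P, t + 1 => zerosAt P (t + 1)
  | (_ + 1) :: _, 0 => 0
  | (_ + 1) :: P, t + 1 => zerosAt P t

theorem eq_of_zerosAt_eq {P Q : List ℕ} (h : P.filter (· ≠ 0) = Q.filter (· ≠ 0))
    (hz : ∀ t, zerosAt P t = zerosAt Q t) : P = Q := by
  induction P generalizing Q with
  | nil =>
    rcases Q with _ | ⟨_ | q, Q⟩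
    · rfl
    · simpa [zerosAt] using hz 0
    · simp at h
  | cons p P ih =>
    rcases Q with _ | ⟨_ | q, Q⟩ <;> rcases p with _ | p
    · simpa [zerosAt] using hz 0
    · simp at h
    · rw [ih (by simpa using h)]
      rintro (_ | t)
      · simpa [zerosAt] using hz 0
      · simpa [zerosAt] using hz (t + 1)
    · simpa [zerosAt] using hz 0
    · simpa [zerosAt] using hz 0
    · simp at h
      rw [h.1, ih (by simpa using h.2)]
      intro t
      simpa [zerosAt] using hz (t + 1)

theorem zerosAt_replicate_append (r : ℕ) (P : List ℕ) (t : ℕ) :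
    zerosAt (List.replicate r 0 ++ P) t = (if t = 0 then r else 0) + zerosAt P t := by
  induction r with
  | zero => simp
  | succ r ih =>
    rcases t with _ | t <;> simp_all [List.replicate_succ, zerosAt]
    omega

/-- The part of a pattern between the `t`-th and the next occurrence of a variable `yⱼ`, counted
from the beginning of the pattern. -/
def PatternCode.segment {A : Type*} : PatternCode A → ℕ → PatternCode A
  | [], _ => []
  | Sum.inr (Sum.inr _) :: _, 0 => []
  | Sum.inr (Sum.inr _) :: U, t + 1 => segment U t
  | Sum.inr (Sum.inl i) :: U, 0 => Sum.inr (Sum.inl i) :: segment U 0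
  | Sum.inl c :: U, 0 => Sum.inl c :: segment U 0
  | Sum.inr (Sum.inl _) :: U, t + 1 => segment U (t + 1)
  | Sum.inl _ :: U, t + 1 => segment U (t + 1)

theorem PatternCode.segment_eq_nil {A : Type*} (U : PatternCode A) :
    ∀ t, U.length < t → U.segment t = [] := by
  induction U with
  | nil => simp [segment]
  | cons s U ih =>
    rintro (_ | t) ht
    · simp at ht
    · simp only [List.length_cons] at ht
      rcases s with c | i | j
      · exact ih _ (by omega)
      · exact ih _ (by omega)
      · exact ih _ (by omega)

theorem PatternCode.length_segment_le {A : Type*} (U : PatternCode A) :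
    ∀ t, (U.segment t).length ≤ U.length := by
  induction U with
  | nil => simp [segment]
  | cons s U ih =>
    rintro (_ | t)
    · have := ih 0
      rcases s with c | i | j <;> simp [segment, this]
    · have := ih t
      have := ih (t + 1)
      rcases s with c | i | j <;> simp only [segment, List.length_cons] <;> omega

/-- The sum of the `k i` over all occurrences of variables `xᵢ` in a pattern, as a function of
`k`. -/
def PatternCode.lin {A : Type*} (U : PatternCode A) : (ℕ → ℕ) →+ ℤ :=
  (U.map (Sum.elim (fun _ => 0) (Sum.elim
    (fun i => (Nat.castAddMonoidHom ℤ).comp (Pi.evalAddMonoidHom (fun _ : ℕ => ℕ) i))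
    (fun _ => 0)))).sum

/-- The number of terminals in a pattern. -/
def PatternCode.numTerminals {A : Type*} (U : PatternCode A) : ℕ := U.countP Sum.isLeft

@[simp] theorem PatternCode.numTerminals_nil {A : Type*} :
    PatternCode.numTerminals ([] : PatternCode A) = 0 := rfl

@[simp] theorem PatternCode.numTerminals_cons_inl {A : Type*} (c : A) (U : PatternCode A) :
    PatternCode.numTerminals (Sum.inl c :: U) = U.numTerminals + 1 :=
  List.countP_cons_of_pos rfl

@[simp] theorem PatternCode.numTerminals_cons_inr {A : Type*} (v : ℕ ⊕ ℕ) (U : PatternCode A) :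
    PatternCode.numTerminals (Sum.inr v :: U) = U.numTerminals :=
  List.countP_cons_of_neg (by simp)

@[simp] theorem PatternCode.lin_nil {A : Type*} (k : ℕ → ℕ) :
    PatternCode.lin ([] : PatternCode A) k = 0 := rfl

@[simp] theorem PatternCode.lin_cons_inl {A : Type*} (k : ℕ → ℕ) (c : A) (U : PatternCode A) :
    PatternCode.lin (Sum.inl c :: U) k = U.lin k := by
  simp [lin]

@[simp] theorem PatternCode.lin_cons_inr_inl {A : Type*} (k : ℕ → ℕ) (i : ℕ)
    (U : PatternCode A) :
    PatternCode.lin (Sum.inr (Sum.inl i) :: U) k = k i + U.lin k := by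
  simp [lin]

@[simp] theorem PatternCode.lin_cons_inr_inr {A : Type*} (k : ℕ → ℕ) (j : ℕ)
    (U : PatternCode A) :
    PatternCode.lin (Sum.inr (Sum.inr j) :: U) k = U.lin k := by
  simp [lin]

theorem PatternCode.lin_nonneg {A : Type*} (U : PatternCode A) (k : ℕ → ℕ) : 0 ≤ U.lin k := by
  induction U with
  | nil => simp
  | cons s U ih => rcases s with c | i | j <;> simp <;> omega

theorem PatternCode.lin_le {A : Type*} (U : PatternCode A) {k : ℕ → ℕ} {b : ℕ}
    (hk : ∀ i, k i ≤ b) : U.lin k ≤ U.length * b := by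
  induction U with
  | nil => simp
  | cons s U ih =>
    rcases s with c | i | j <;>
      simp only [lin_cons_inl, lin_cons_inr_inl, lin_cons_inr_inr, List.length_cons, Nat.cast_succ,
        add_mul, one_mul]
    · omega
    · have := hk i
      omega
    · omega

theorem PatternCode.zerosAt_flat {A : Type*} (k : ℕ → ℕ) (U : PatternCode A) :
    ∀ t, (zerosAt (U.flat k) t : ℤ) = (U.segment t).lin k + (U.segment t).numTerminals := by
  induction U with
  | nil => simp [zerosAt, segment]
  | cons s U ih =>
    rcases s with c | i | j <;> rintro (_ | t) <;>
      simp_all [zerosAt, segment, zerosAt_replicate_append] <;> ring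

theorem PatternCode.count_zero_flat {A : Type*} (k : ℕ → ℕ) (U : PatternCode A) :
    ((U.flat k).count 0 : ℤ) = U.lin k + U.numTerminals := by
  induction U with
  | nil => simp
  | cons s U ih =>
    rcases s with c | i | j <;> simp_all <;> ring

theorem PatternCode.filter_flat {A : Type*} (k k' : ℕ → ℕ) (U : PatternCode A) :
    (U.flat k).filter (· ≠ 0) = (U.flat k').filter (· ≠ 0) := by
  induction U with
  | nil => rfl
  | cons s U ih => rcases s with c | i | j <;> simpa using ih

/-- The two patterns of an atom. -/
def Token.sides {A : Type*} : Token A → PatternCode A × PatternCode A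
  | Sum.inl _ => ([], [])
  | Sum.inr (Sum.inl p) => p
  | Sum.inr (Sum.inr p) => p

/-- The whole pattern, or one of its segments. -/
def PatternCode.part {A : Type*} (U : PatternCode A) : Option ℕ → PatternCode A
  | none => U
  | some t => U.segment t

theorem PatternCode.length_part_le {A : Type*} (U : PatternCode A) (t : Option ℕ) :
    (U.part t).length ≤ U.length := by
  cases t with
  | none => exact le_rfl
  | some t => exact U.length_segment_le t

/-- The linear equation in `k` which says that the parts number `t` of the patterns `U` and `V`
have equal lengths when the lengths of the `xᵢ` are `k i`. -/
def PartEq {A : Type*} (k : ℕ → ℕ) (U V : PatternCode A) (t : Option ℕ) : Prop :=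
  (U.part t).lin k - (V.part t).lin k
    = ((V.part t).numTerminals : ℤ) - (U.part t).numTerminals

theorem perm_flat_of_partEq {A : Type*} {k k' : ℕ → ℕ} {U V : PatternCode A}
    (h : PartEq k U V none → PartEq k' U V none) (hp : (U.flat k).Perm (V.flat k)) :
    (U.flat k').Perm (V.flat k') := by
  have h₀ : (U.flat k').count 0 = (V.flat k').count 0 := by
    have := hp.count_eq 0
    zify [PatternCode.count_zero_flat] at this ⊢
    simp only [PartEq, PatternCode.part] at h
    have := h (by linarith)
    linarith
  have hf := hp.filter (· ≠ 0)
  rw [U.filter_flat k k', V.filter_flat k k'] at hf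
  refine List.perm_iff_count.2 fun z => ?_
  by_cases hz : z = 0
  · rw [hz, h₀]
  · have := hf.count_eq z
    rwa [List.count_filter (by simpa using hz), List.count_filter (by simpa using hz)] at this

theorem flat_eq_of_partEq {A : Type*} {k k' : ℕ → ℕ} {U V : PatternCode A}
    (h : ∀ t, PartEq k U V (some t) → PartEq k' U V (some t)) (hp : U.flat k = V.flat k) :
    U.flat k' = V.flat k' := by
  refine eq_of_zerosAt_eq ?_ fun t => ?_
  · rw [U.filter_flat k' k, V.filter_flat k' k, hp]
  · have := congrArg (zerosAt · t) hp
    zify [PatternCode.zerosAt_flat] at this ⊢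
    have h' := h t
    simp only [PartEq, PatternCode.part] at h'
    have := h' (by linarith)
    linarith

theorem Token.IsIdentity.of_partEq {A : Type*} {k k' : ℕ → ℕ} {τ : Token A}
    (h : ∀ t, PartEq k τ.sides.1 τ.sides.2 t → PartEq k' τ.sides.1 τ.sides.2 t)
    (hτ : τ.IsIdentity k) : τ.IsIdentity k' := by
  rcases τ with b | p | p
  · exact hτ
  · exact ⟨perm_flat_of_partEq (h none) hτ.1, fun hA => flat_eq_of_partEq (fun t => h _) (hτ.2 hA)⟩
  · exact perm_flat_of_partEq (h none) hτ

/-- A bound for the lengths of the `xᵢ`, in terms of a bound `s` for the number of tokens of a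
formula and for the lengths of the patterns in it. -/
def lengthBound (s : ℕ) : ℕ := 2 ^ (2 * s + 1) ^ (s * (s + 2))

theorem exists_small_identity {A : Type*} {s : ℕ} (ts : List (Token A)) (hts : ts.length ≤ s)
    (hs : ∀ τ ∈ ts, τ.sides.1.length ≤ s ∧ τ.sides.2.length ≤ s) (k : ℕ → ℕ) {b : ℕ}
    (hk : ∀ i, k i ≤ b) :
    ∃ k' : ℕ → ℕ, (∀ i, k' i < lengthBound s) ∧
      ∀ τ ∈ ts, τ.IsIdentity k → τ.IsIdentity k' := by
  let R := Fin ts.length × Option (Fin (s + 1))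
  let U : R → PatternCode A := fun r => (ts[r.1].sides.1).part (r.2.map Fin.val)
  let V : R → PatternCode A := fun r => (ts[r.1].sides.2).part (r.2.map Fin.val)
  have hU : ∀ r, (U r).length ≤ s := fun r =>
    (PatternCode.length_part_le _ _).trans (hs _ (List.getElem_mem _)).1
  have hV : ∀ r, (V r).length ≤ s := fun r =>
    (PatternCode.length_part_le _ _).trans (hs _ (List.getElem_mem _)).2
  obtain ⟨k', hk', h⟩ := exists_small_solution (fun r => (U r).lin - (V r).lin)
    (fun r => ((V r).numTerminals : ℤ) - (U r).numTerminals) s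
    (by
      intro r k b hk
      have h₁ := (U r).lin_le hk
      have h₂ := (V r).lin_le hk
      have h₃ := (U r).lin_nonneg k
      have h₄ := (V r).lin_nonneg k
      have h₅ : ((U r).length : ℤ) * b ≤ s * b := by exact_mod_cast Nat.mul_le_mul_right b (hU r)
      have h₆ : ((V r).length : ℤ) * b ≤ s * b := by exact_mod_cast Nat.mul_le_mul_right b (hV r)
      rw [AddMonoidHom.sub_apply]
      exact abs_le.2 ⟨by linarith, by linarith⟩)
    (by
      intro r
      have h₁ : (U r).numTerminals ≤ s := List.countP_le_length.trans (hU r)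
      have h₂ : (V r).numTerminals ≤ s := List.countP_le_length.trans (hV r)
      exact abs_le.2 ⟨by omega, by omega⟩)
    k b (fun i => (hk i).trans_lt b.lt_two_pow_self)
  refine ⟨k', fun i => (hk' i).trans_le ?_, fun τ hτ => Token.IsIdentity.of_partEq ?_⟩
  · refine Nat.pow_le_pow_right two_pos (Nat.pow_le_pow_right (by omega) ?_)
    simpa [R] using Nat.mul_le_mul_right (s + 2) hts
  · obtain ⟨i, hi, rfl⟩ := List.getElem_of_mem hτ
    rintro (_ | t) ht
    · exact h (⟨i, hi⟩, none) ht
    · by_cases hts : t < s + 1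
      · exact h (⟨i, hi⟩, some ⟨t, hts⟩) ht
      · have := hs _ (List.getElem_mem hi)
        simp only [PartEq, PatternCode.part]
        rw [PatternCode.segment_eq_nil _ t (by omega), PatternCode.segment_eq_nil _ t (by omega)]
        simp

/-! ### Evaluating formulae in prefix notation -/

/-- One step of the evaluation of a formula in prefix notation, read from right to left, on a
stack of truth values; `none` is a stack underflow. -/
def evalStep {A : Type*} (v : Token A → Bool) (τ : Token A) (st : Option (List Bool)) :
    Option (List Bool) :=
  st.bind fun l => Sum.elim
    (fun b => l.head?.bind fun x => l.tail.head?.map fun y =>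
      (bif b then x && y else x || y) :: l.tail.tail)
    (fun e => some (v (Sum.inr e) :: l)) τ

/-- The stack that is left after the evaluation of all tokens. The value of the token read last is
on top, so a code of a formula leaves a single truth value. -/
def evalTokens {A : Type*} (v : Token A → Bool) (ts : List (Token A)) : Option (List Bool) :=
  ts.foldr (evalStep v) (some [])

/-- The truth value of a formula whose atoms have the truth values `v`. -/
def PosFormula.value {A : Type*} {n m : ℕ} (v : Token A → Bool) :
    PosFormula A (Fin n ⊕ Fin m) → Bool
  | .atom e => v e.code
  | .and φ ψ => φ.value v && ψ.value v
  | .or φ ψ => φ.value v || ψ.value v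

theorem PosFormula.value_eq_true_iff {A : Type*} {n m : ℕ} (v : Token A → Bool)
    (φ : PosFormula A (Fin n ⊕ Fin m)) : φ.value v = true ↔ φ.Eval fun e => v e.code = true := by
  induction φ with
  | atom e => rfl
  | and φ ψ ih₁ ih₂ => simp [value, Eval, ih₁, ih₂]
  | or φ ψ ih₁ ih₂ => simp [value, Eval, ih₁, ih₂]

theorem PosFormula.evalTokens_code_append {A : Type*} {n m : ℕ} (v : Token A → Bool)
    (φ : PosFormula A (Fin n ⊕ Fin m)) (r : List (Token A)) :
    evalTokens v (φ.code ++ r) = (evalTokens v r).map (φ.value v :: ·) := by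
  induction φ generalizing r with
  | atom e => cases e <;> cases h : evalTokens v r <;> simp_all [evalTokens, code, evalStep, value,
      Atom.code]
  | and φ ψ ih₁ ih₂ =>
    have : evalTokens v ((and φ ψ).code ++ r)
        = evalStep v (Sum.inl true) (evalTokens v (φ.code ++ (ψ.code ++ r))) := by
      simp [evalTokens, code]
    rw [this, ih₁, ih₂]
    cases evalTokens v r <;> simp [evalStep, value]
  | or φ ψ ih₁ ih₂ =>
    have : evalTokens v ((or φ ψ).code ++ r)
        = evalStep v (Sum.inl false) (evalTokens v (φ.code ++ (ψ.code ++ r))) := by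
      simp [evalTokens, code]
    rw [this, ih₁, ih₂]
    cases evalTokens v r <;> simp [evalStep, value]

/-- The token is a connective, or the code of an atom over the variables `x₁, …, xₙ, y₁, …, yₘ`
in which `a` is the only terminal if it is a word equation. -/
def Token.Valid {A : Type*} (a : A) (n m : ℕ) : Token A → Prop
  | Sum.inl _ => True
  | Sum.inr (Sum.inl p) => ∀ s ∈ p.1 ++ p.2, Sum.elim (· = a) (Sum.elim (· < n) (· < m)) s
  | Sum.inr (Sum.inr p) =>
    ∀ s ∈ p.1 ++ p.2, Sum.elim (fun _ => True) (Sum.elim (· < n) (· < m)) s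

theorem Pattern.exists_code_eq {A : Type*} {n m : ℕ} (U : PatternCode A)
    (hU : ∀ s ∈ U, Sum.elim (fun _ => True) (Sum.elim (· < n) (· < m)) s) :
    ∃ U' : Pattern A (Fin n ⊕ Fin m), Pattern.code U' = U := by
  have : U ∈ Set.range (List.map (Sum.map (id : A → A)
      (Sum.map (Fin.val : Fin n → ℕ) (Fin.val : Fin m → ℕ)))) := by
    rw [Set.range_list_map]
    rintro (c | i | j) hs
    · exact ⟨Sum.inl c, rfl⟩
    · exact ⟨Sum.inr (Sum.inl ⟨i, hU _ hs⟩), rfl⟩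
    · exact ⟨Sum.inr (Sum.inr ⟨j, hU _ hs⟩), rfl⟩
  exact this

theorem Atom.exists_code_eq {A : Type*} {a : A} {n m : ℕ}
    (e : (PatternCode A × PatternCode A) ⊕ (PatternCode A × PatternCode A))
    (he : Token.Valid a n m (Sum.inr e)) :
    ∃ e' : Atom A (Fin n ⊕ Fin m), e'.code = Sum.inr e ∧ e'.OnlyTerminal a := by
  rcases e with ⟨U, V⟩ | ⟨U, V⟩
  · have hw : ∀ s ∈ U ++ V, Sum.elim (fun _ => True) (Sum.elim (· < n) (· < m)) s := by
      rintro (c | i | j) hs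
      · trivial
      · exact he _ hs
      · exact he _ hs
    obtain ⟨U, rfl⟩ := Pattern.exists_code_eq U fun s hs => hw s (by simp [hs])
    obtain ⟨V, rfl⟩ := Pattern.exists_code_eq V fun s hs => hw s (by simp [hs])
    refine ⟨.eqn U V, rfl, fun c hc => he (Sum.inl c) ?_⟩
    simp only [Pattern.code, ← List.map_append]
    exact List.mem_map_of_mem hc
  · obtain ⟨U, rfl⟩ := Pattern.exists_code_eq U fun s hs => he s (by simp [hs])
    obtain ⟨V, rfl⟩ := Pattern.exists_code_eq V fun s hs => he s (by simp [hs])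
    exact ⟨.len U V, rfl, trivial⟩

theorem Atom.valid_code {A : Type*} {a : A} {n m : ℕ} {e : Atom A (Fin n ⊕ Fin m)}
    (he : e.OnlyTerminal a) : Token.Valid a n m e.code := by
  rcases e with ⟨U, V⟩ | ⟨U, V⟩ <;> simp only [code, Token.Valid, Pattern.code, ← List.map_append]
  all_goals
    intro s hs
    obtain ⟨t, ht, rfl⟩ := List.mem_map.1 hs
    rcases t with c | i | j
  · exact he c ht
  · exact i.isLt
  · exact j.isLt
  · trivial
  · exact i.isLt
  · exact j.isLt

theorem PosFormula.valid_code {A : Type*} {a : A} {n m : ℕ} {φ : PosFormula A (Fin n ⊕ Fin m)}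
    (h : φ.OnlyTerminal a) : ∀ τ ∈ φ.code, Token.Valid a n m τ := by
  induction φ with
  | atom e =>
    intro τ hτ
    obtain rfl := List.mem_singleton.1 hτ
    exact Atom.valid_code h
  | and φ ψ ih₁ ih₂ =>
    intro τ hτ
    simp only [code, List.mem_cons, List.mem_append] at hτ
    rcases hτ with rfl | hτ | hτ
    exacts [trivial, ih₁ h.1 τ hτ, ih₂ h.2 τ hτ]
  | or φ ψ ih₁ ih₂ =>
    intro τ hτ
    simp only [code, List.mem_cons, List.mem_append] at hτ
    rcases hτ with rfl | hτ | hτ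
    exacts [trivial, ih₁ h.1 τ hτ, ih₂ h.2 τ hτ]

/-- If the evaluation of a list of valid tokens does not underflow, then the list is a
concatenation of codes of formulae, whose truth values are left on the stack. -/
theorem exists_formulas_of_evalTokens {A : Type*} {a : A} {n m : ℕ} (v : Token A → Bool)
    (ts : List (Token A)) (hts : ∀ τ ∈ ts, Token.Valid a n m τ) {l : List Bool}
    (h : evalTokens v ts = some l) :
    ∃ φs : List (PosFormula A (Fin n ⊕ Fin m)), (∀ φ ∈ φs, φ.OnlyTerminal a) ∧
      ts = φs.flatMap PosFormula.code ∧ l = φs.map (PosFormula.value v) := by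
  induction ts generalizing l with
  | nil => exact ⟨[], by simp_all [evalTokens]⟩
  | cons τ ts ih =>
    have h' : evalStep v τ (evalTokens v ts) = some l := h
    cases hl' : evalTokens v ts with
    | none => simp [hl', evalStep] at h'
    | some l' =>
      obtain ⟨φs, hφs, rfl, rfl⟩ := ih (fun σ hσ => hts σ (by simp [hσ])) hl'
      rw [hl'] at h'
      rcases τ with b | e
      · rcases φs with _ | ⟨φ, _ | ⟨ψ, φs⟩⟩
        · simp [evalStep] at h'
        · simp [evalStep] at h'
        · have h₁ := hφs φ (by simp)
          have h₂ := hφs ψ (by simp)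
          have h₃ : ∀ χ ∈ φs, χ.OnlyTerminal a := fun χ hχ => hφs χ (by simp [hχ])
          simp [evalStep] at h'
          cases b
          · refine ⟨.or φ ψ :: φs, ?_, ?_, ?_⟩
            · rintro χ (_ | ⟨_, hχ⟩)
              exacts [⟨h₁, h₂⟩, h₃ χ hχ]
            · simp [PosFormula.code]
            · simp [← h', PosFormula.value]
          · refine ⟨.and φ ψ :: φs, ?_, ?_, ?_⟩
            · rintro χ (_ | ⟨_, hχ⟩)
              exacts [⟨h₁, h₂⟩, h₃ χ hχ]
            · simp [PosFormula.code]
            · simp [← h', PosFormula.value]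
      · obtain ⟨e', he', hea⟩ := Atom.exists_code_eq e (hts _ (by simp))
        refine ⟨.atom e' :: φs, ?_, ?_, ?_⟩
        · rintro χ (_ | ⟨_, hχ⟩)
          exacts [hea, hφs χ hχ]
        · simp [PosFormula.code, he']
        · simp [evalStep] at h'
          simp [← h', PosFormula.value, he']

theorem PosFormula.code_mem_of_mem_atoms {A : Type*} {n m : ℕ} (φ : PosFormula A (Fin n ⊕ Fin m)) :
    ∀ e ∈ φ.atoms, e.code ∈ φ.code := by
  induction φ with
  | atom e => simp [atoms, code]
  | and φ ψ ih₁ ih₂ =>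
    intro e he
    have := (List.mem_append.1 he).imp (ih₁ e) (ih₂ e)
    simp [code, this]
  | or φ ψ ih₁ ih₂ =>
    intro e he
    have := (List.mem_append.1 he).imp (ih₁ e) (ih₂ e)
    simp [code, this]

theorem Atom.isIdentity_code_congr {A : Type*} (a : A) {n m : ℕ} {k k' : ℕ → ℕ}
    (hk : ∀ i < n, k i = k' i) {e : Atom A (Fin n ⊕ Fin m)} (h : Token.IsIdentity k e.code) :
    Token.IsIdentity k' e.code := by
  have hflat : ∀ U : Pattern A (Fin n ⊕ Fin m),
      (Pattern.code U).flat k = (Pattern.code U).flat k' := fun U => by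
    rw [Pattern.flat_code (fun i : Fin n => List.replicate (k i) a) k (by simp),
      Pattern.flat_code (fun i : Fin n => List.replicate (k i) a) k'
        (fun i => by simp [hk i i.isLt])]
  cases e <;> simpa only [code, Token.IsIdentity, hflat] using h

/-! ### The decision procedure -/

section Decision

open Encodable Primrec

variable {A : Type*} [Primcodable A]

theorem length_sides_le (τ : Token A) :
    τ.sides.1.length ≤ encode τ ∧ τ.sides.2.length ≤ encode τ := by
  rcases τ with b | ⟨U, V⟩ | ⟨U, V⟩
  · simp [Token.sides]
  all_goals
    have h₁ := (Encodable.length_le_encode U).trans (Nat.left_le_pair _ (encode V))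
    have h₂ := (Encodable.length_le_encode V).trans (Nat.right_le_pair (encode U) _)
    simp only [Token.sides, encode_inr, encode_inl, encode_prod_val]
    omega

theorem encode_le_of_mem {α : Type*} [Encodable α] {x : α} {l : List α} (h : x ∈ l) :
    encode x ≤ encode l := by
  induction l with
  | nil => simp at h
  | cons y l ih =>
    rw [encode_list_cons]
    rcases List.mem_cons.1 h with rfl | h
    · exact (Nat.left_le_pair _ _).trans (Nat.le_succ _)
    · exact (ih h).trans ((Nat.right_le_pair _ _).trans (Nat.le_succ _))

/-- The `i`-th digit of `K` in base `β`, where `p = (β, K)`. -/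
def digit (p : ℕ × ℕ) (i : ℕ) : ℕ := p.2 / p.1 ^ i % p.1

theorem exists_digit_eq {n β : ℕ} (k : ℕ → ℕ) (hk : ∀ i, k i < β) :
    ∃ K < β ^ n, ∀ i < n, digit (β, K) i = k i := by
  refine ⟨finFunctionFinEquiv fun i : Fin n => (⟨k i, hk i⟩ : Fin β), Fin.isLt _, fun i hi => ?_⟩
  have := congrFun (finFunctionFinEquiv.symm_apply_apply
    fun i : Fin n => (⟨k i, hk i⟩ : Fin β)) ⟨i, hi⟩
  exact congrArg Fin.val this

open Classical in
/-- The truth value of `Token.IsIdentity` when the exponents are the digits of a number. -/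
noncomputable def tokenValue {A : Type*} (p : ℕ × ℕ) (τ : Token A) : Bool :=
  decide (τ.IsIdentity (digit p))

theorem tokenValue_eq_true_iff {A : Type*} {p : ℕ × ℕ} {τ : Token A} :
    tokenValue p τ = true ↔ τ.IsIdentity (digit p) := by
  simp [tokenValue]

/-- The condition on codes that is decided: all tokens are valid, and the formula evaluates to
true for some choice of exponents below the bound. -/
def Accepts (a : A) (w : SentenceCode A) : Prop :=
  (∀ τ ∈ w.2.2, Token.Valid a w.1 w.2.1 τ) ∧
    ∃ K < lengthBound (encode w.2.2) ^ w.1,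
      evalTokens (tokenValue (lengthBound (encode w.2.2), K)) w.2.2 = some [true]

theorem accepts_iff (a : A) (w : SentenceCode A) :
    Accepts a w ↔ ∃ S : Sentence A, S.code = w ∧ S.body.OnlyTerminal a ∧ S.Holds := by
  constructor
  · obtain ⟨n, m, ts⟩ := w
    rintro ⟨hts, K, -, h⟩
    obtain ⟨φs, hφs, hcode, hl⟩ := exists_formulas_of_evalTokens _ ts hts h
    obtain ⟨φ, rfl⟩ : ∃ φ, φs = [φ] :=
      List.length_eq_one_iff.1 (by simpa using congrArg List.length hl.symm)
    have hφ := hφs φ (by simp)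
    refine ⟨⟨n, m, φ⟩, by simpa [Sentence.code] using hcode.symm, hφ, (Sentence.holds_iff _ hφ).2
      ⟨digit (lengthBound (encode ts), K), ?_⟩⟩
    simp only [List.map_cons, List.map_nil, List.cons.injEq, and_true] at hl
    exact ((φ.value_eq_true_iff _).1 hl.symm).mono fun e _ he => tokenValue_eq_true_iff.1 he
  · rintro ⟨⟨n, m, φ⟩, rfl, hφ, h⟩
    refine ⟨PosFormula.valid_code hφ, ?_⟩
    obtain ⟨k, hk⟩ := (Sentence.holds_iff _ hφ).1 h
    change ∃ K < lengthBound (encode φ.code) ^ n,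
      evalTokens (tokenValue (lengthBound (encode φ.code), K)) φ.code = some [true]
    set β := lengthBound (encode φ.code)
    let k₀ : ℕ → ℕ := fun i => if i < n then k i else 0
    have hk₀ : ∀ i, k₀ i ≤ ∑ j ∈ Finset.range n, k j := by
      intro i
      by_cases hi : i < n
      · simpa [k₀, hi] using
          Finset.single_le_sum (f := k) (fun _ _ => Nat.zero_le _) (Finset.mem_range.2 hi)
      · simp [k₀, hi]
    -- `k` is cut off at `n` to make it bounded; only `k i` with `i < n` matters
    obtain ⟨k₁, hk₁, h₁⟩ := exists_small_identity φ.code (Encodable.length_le_encode _)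
      (fun τ hτ => ⟨(length_sides_le τ).1.trans (encode_le_of_mem hτ),
        (length_sides_le τ).2.trans (encode_le_of_mem hτ)⟩) k₀ hk₀
    obtain ⟨K, hK, hKd⟩ := exists_digit_eq (n := n) k₁ hk₁
    refine ⟨K, hK, ?_⟩
    have hval : φ.value (tokenValue (β, K)) = true := by
      refine (φ.value_eq_true_iff _).2 (hk.mono fun e he hid => ?_)
      refine tokenValue_eq_true_iff.2 ?_
      refine Atom.isIdentity_code_congr a (fun i hi => (hKd i hi).symm) ?_
      refine h₁ _ (φ.code_mem_of_mem_atoms e he) ?_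
      exact Atom.isIdentity_code_congr a (fun i hi => by simp [k₀, hi]) hid
    simpa [evalTokens, hval] using φ.evalTokens_code_append (tokenValue (β, K)) []

theorem primrecPred_const {α : Type*} [Primcodable α] (p : Prop) :
    PrimrecPred fun _ : α => p := by
  classical
  exact Primrec.primrecPred (Primrec.const (decide p))

theorem primrecRel_sumElim {α β γ : Type*} [Primcodable α] [Primcodable β] [Primcodable γ]
    {p : α → β → Prop} {q : α → γ → Prop} (hp : PrimrecRel p) (hq : PrimrecRel q) :
    PrimrecRel fun x s => Sum.elim (p x) (q x) s := by
  classical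
  refine Primrec.primrecPred (p := fun r : α × (β ⊕ γ) => Sum.elim (p r.1) (q r.1) r.2)
    ((sumCasesOn snd (hp.decide.comp (fst.comp fst) snd).to₂
      (hq.decide.comp (fst.comp fst) snd).to₂).of_eq ?_)
  rintro ⟨x, s | s⟩ <;> exact decide_eq_decide.2 Iff.rfl

theorem primrec_pow : Primrec₂ ((· ^ ·) : ℕ → ℕ → ℕ) :=
  Primrec₂.unpaired'.1 Nat.Primrec.pow

theorem primrec_digit : Primrec₂ digit :=
  nat_mod.comp (nat_div.comp (snd.comp fst) (primrec_pow.comp (fst.comp fst) snd))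
    (fst.comp fst)

theorem primrec_flat :
    Primrec₂ fun (p : ℕ × ℕ) (U : PatternCode A) => PatternCode.flat (digit p) U := by
  have hrep : Primrec fun r : ℕ => List.replicate r 0 :=
    (list_map list_range (Primrec.const 0).to₂).of_eq fun r => by simp
  have hx : Primrec₂ fun (q : (ℕ × ℕ) × (A ⊕ (ℕ ⊕ ℕ))) (i : ℕ) =>
      List.replicate (digit q.1 i) 0 :=
    hrep.comp (primrec_digit.comp (fst.comp fst) snd)
  have hsym : Primrec₂ fun (p : ℕ × ℕ) (s : A ⊕ (ℕ ⊕ ℕ)) => Sum.elim (fun _ => [0])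
      (Sum.elim (fun i => List.replicate (digit p i) 0) (fun j => [j + 1])) s := by
    refine (sumCasesOn (γ := ℕ ⊕ ℕ) snd (Primrec.const [0]).to₂ (sumCasesOn (γ := ℕ) snd
      (hrep.comp (primrec_digit.comp (fst.comp (fst.comp fst)) snd)).to₂
      (list_cons.comp (succ.comp snd) (Primrec.const [])).to₂).to₂).of_eq ?_
    rintro ⟨p, c | i | j⟩ <;> rfl
  exact list_flatMap snd (hsym.comp (fst.comp fst) snd)

theorem primrecRel_perm : PrimrecRel (List.Perm : List ℕ → List ℕ → Prop) := by
  have hcount : Primrec₂ fun (P : List ℕ) (z : ℕ) => P.count z :=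
    (list_length.comp₂ (PrimrecRel.listFilter (R := fun x z : ℕ => x = z) Primrec.eq)).of_eq
      fun P z => by rw [List.count_eq_length_filter]; rfl
  have h : PrimrecRel fun (z : ℕ) (q : List ℕ × List ℕ) => q.1.count z = q.2.count z :=
    Primrec.eq.comp (hcount.comp (fst.comp snd) fst) (hcount.comp (snd.comp snd) fst)
  refine (h.forall_mem_list.comp (list_append.comp fst snd) Primrec.id).of_eq ?_
  rintro ⟨P, Q⟩
  refine ⟨fun h => List.perm_iff_count.2 fun z => ?_, fun h z _ => h.count_eq z⟩
  by_cases hz : z ∈ P ++ Q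
  · exact h z hz
  · rw [List.mem_append, not_or] at hz
    rw [List.count_eq_zero_of_not_mem hz.1, List.count_eq_zero_of_not_mem hz.2]

theorem primrec_tokenValue : Primrec₂ (tokenValue (A := A)) := by
  classical
  have h₁ : Primrec₂ fun (p : ℕ × ℕ) (e : PatternCode A × PatternCode A) =>
      e.1.flat (digit p) := primrec_flat.comp fst (fst.comp snd)
  have h₂ : Primrec₂ fun (p : ℕ × ℕ) (e : PatternCode A × PatternCode A) =>
      e.2.flat (digit p) := primrec_flat.comp fst (snd.comp snd)
  have hlen : PrimrecRel fun (p : ℕ × ℕ) (e : PatternCode A × PatternCode A) =>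
      (e.1.flat (digit p)).Perm (e.2.flat (digit p)) := primrecRel_perm.comp h₁ h₂
  have heqn : PrimrecRel fun (p : ℕ × ℕ) (e : PatternCode A × PatternCode A) =>
      (e.1.flat (digit p)).Perm (e.2.flat (digit p)) ∧
        (Nontrivial A → e.1.flat (digit p) = e.2.flat (digit p)) := by
    by_cases hA : Nontrivial A
    · exact (hlen.and (Primrec.eq.comp h₁ h₂)).of_eq fun _ => by simp [hA]
    · exact hlen.of_eq fun _ => by simp [hA]
  have h := primrecRel_sumElim (p := fun (_ : ℕ × ℕ) (_ : Bool) => False) (primrecPred_const _)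
    (primrecRel_sumElim heqn hlen)
  exact PrimrecRel.decide (R := fun (p : ℕ × ℕ) (τ : Token A) => τ.IsIdentity (digit p))
    (h.of_eq (by rintro p (b | e | e) <;> rfl))

theorem primrec_evalTokens : Primrec₂ fun (p : ℕ × ℕ) (ts : List (Token A)) =>
    evalTokens (tokenValue p) ts := by
  have hstep : Primrec₂ fun (p : ℕ × ℕ) (q : Token A × Option (List Bool)) =>
      evalStep (tokenValue p) q.1 q.2 := by
    have hl : Primrec fun r : ((((ℕ × ℕ) × Token A × Option (List Bool)) × List Bool) × Bool) =>
        r.1.2 := snd.comp fst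
    have hop : Primrec₂ fun (r : ((((ℕ × ℕ) × Token A × Option (List Bool)) × List Bool) × Bool) ×
        Bool) (y : Bool) => (bif r.1.2 then r.2 && y else r.2 || y) :: r.1.1.2.tail.tail :=
      list_cons.comp
        (Primrec.cond (snd.comp (fst.comp fst)) (Primrec.and.comp (snd.comp fst) snd)
          (Primrec.or.comp (snd.comp fst) snd))
        (list_tail.comp (list_tail.comp (hl.comp (fst.comp fst))))
    have hconn := option_bind (list_head?.comp hl)
      (option_map (list_head?.comp (list_tail.comp (hl.comp fst))) hop).to₂
    have hatom : Primrec₂ fun (r : ((ℕ × ℕ) × Token A × Option (List Bool)) × List Bool)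
        (e : (PatternCode A × PatternCode A) ⊕ (PatternCode A × PatternCode A)) =>
        some (tokenValue r.1.1 (Sum.inr e) :: r.2) :=
      option_some.comp (list_cons.comp
        (primrec_tokenValue.comp (fst.comp (fst.comp fst)) (sumInr.comp snd)) (snd.comp fst))
    refine (option_bind (snd.comp snd)
      (sumCasesOn (fst.comp (snd.comp fst)) hconn.to₂ hatom).to₂).of_eq ?_
    rintro ⟨p, b | e, st⟩ <;> rfl
  exact list_foldr snd (Primrec.const (some [])) (hstep.comp (fst.comp fst) snd).to₂

theorem primrec_lengthBound : Primrec lengthBound := by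
  have h : Primrec fun s : ℕ => 2 * s + 1 := succ.comp (nat_mul.comp (Primrec.const 2) Primrec.id)
  have h' : Primrec fun s : ℕ => s * (s + 2) :=
    nat_mul.comp Primrec.id (nat_add.comp Primrec.id (Primrec.const 2))
  exact primrec_pow.comp (Primrec.const 2) (primrec_pow.comp h h')

theorem primrecRel_valid (a : A) :
    PrimrecRel fun (τ : Token A) (q : ℕ × ℕ) => Token.Valid a q.1 q.2 τ := by
  have hside : ∀ p : A → Prop, PrimrecPred p →
      PrimrecRel fun (q : ℕ × ℕ) (e : PatternCode A × PatternCode A) =>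
        ∀ s ∈ e.1 ++ e.2, Sum.elim p (Sum.elim (· < q.1) (· < q.2)) s := fun p hp =>
    have hsym := primrecRel_sumElim (p := fun (_ : ℕ × ℕ) => p) (hp.comp snd)
      (primrecRel_sumElim (p := fun (q : ℕ × ℕ) (i : ℕ) => i < q.1)
        (q := fun (q : ℕ × ℕ) (j : ℕ) => j < q.2) (nat_lt.comp snd (fst.comp fst))
        (nat_lt.comp snd (snd.comp fst)))
    hsym.swap.forall_mem_list.comp (list_append.comp (fst.comp snd) (snd.comp snd)) fst
  have h := primrecRel_sumElim (p := fun (_ : ℕ × ℕ) (_ : Bool) => True) (primrecPred_const _)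
    (primrecRel_sumElim (hside (· = a) (Primrec.eq.comp Primrec.id (Primrec.const a)))
      (hside (fun _ => True) (primrecPred_const _)))
  exact h.swap.of_eq (by rintro (b | e | e) q <;> rfl)

theorem primrecPred_accepts (a : A) : PrimrecPred (Accepts a) := by
  have hts : Primrec fun w : SentenceCode A => w.2.2 := snd.comp snd
  have hβ : Primrec fun w : SentenceCode A => lengthBound (encode w.2.2) :=
    primrec_lengthBound.comp (Primrec.encode.comp hts)
  have hvalid : PrimrecPred fun w : SentenceCode A => ∀ τ ∈ w.2.2, Token.Valid a w.1 w.2.1 τ :=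
    (primrecRel_valid a).forall_mem_list.comp hts (Primrec.pair fst (fst.comp snd))
  have heval : PrimrecRel fun (K : ℕ) (w : SentenceCode A) =>
      evalTokens (tokenValue (lengthBound (encode w.2.2), K)) w.2.2 = some [true] :=
    Primrec.eq.comp (primrec_evalTokens.comp (Primrec.pair (hβ.comp snd) fst) (hts.comp snd))
      (Primrec.const _)
  have hsearch := heval.exists_mem_list.comp
    (list_range.comp (primrec_pow.comp hβ fst)) (Primrec.id (α := SentenceCode A))
  exact (hvalid.and hsearch).of_eq fun w => by simp [Accepts]

end Decision
end WordEq

open WordEq in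
theorem mainTheorem5 (A : Type*) [Finite A] [Primcodable A] (a : A) :
    ComputablePred (fun w : SentenceCode A =>
      ∃ S : Sentence A, S.code = w ∧ S.body.OnlyTerminal a ∧ S.Holds) ∧
    (Nontrivial A → ∀ S : Sentence A, S.body.OnlyTerminal a → ∀ x : Fin S.n → List A,
      (∀ y : Fin S.m → List A, S.body.Holds (Sum.elim x y)) ↔
        ∃ c ∈ S.body.dnf, ∀ e ∈ c, (e.assign x).IsTrivial) := by
  refine ⟨((primrecPred_accepts a).of_eq (accepts_iff a)).computablePred, fun _ S _ x => ?_⟩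
  rw [PosFormula.forall_holds_iff a, ← PosFormula.exists_mem_dnf_iff_eval]
  simp only [Atom.isIdentity_iff_isTrivial]
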